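/- Let $\ell\in\mathbb{N}\cup\{0\}$. For $n\ge 0$ let $b_\ell(n)$ denote the number of partitions of $n$ into distinct parts such that (number of parts)${}+\ell$ is not a part (the empty partition is counted, so $b_\ell(0)=1$). For integers $N,M$ and $k\ge 0$ let $p(N,M,k)$ denote the number of partitions of $k$ into at most $M$ parts, each $\le N$, i.e. the number of sequences of integers $N\ge\lambda_1\ge\cdots\ge\lambda_M\ge 0$ with sum $k$; in particular $p(N,M,k)=0$ if $M<0$, or if $M>0$ and $N<0$, while for every integer $N$ we have $p(N,0,0)=1$ and $p(N,0,k)=0$ for $k>0$. Then, as formal Laurent series in $q$ (the sum on the right being formally convergent), $$\sum_{n=0}^{\infty} b_{\ell}(n)q^n\equiv\sum_{j,m=-\infty}^{\infty}\sum_{k=0}^{\infty}\Big(p\big(\ell-1-\big\lfloor\tfrac{\ell+1-5j}{2}\big\rfloor,\big\lfloor\tfrac{\ell+1-5j}{2}\big\rfloor,k\big)+p\big(\ell-1-\big\lfloor\tfrac{\ell-1-5m}{2}\big\rfloor,\big\lfloor\tfrac{\ell-1-5m}{2}\big\rfloor,k\big)\Big)\,q^{\frac{j(5j-3)}{2}+\frac{m(5m+1)}{2}-\frac{\ell(\ell-1)}{2}+k}\pmod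 2,$$ that is, for every $e\in\mathbb{Z}$ the coefficients of $q^e$ on the two sides are congruent modulo $2$. As a corollary, for every $n\ge 0$: (i) $b_1(n)$ is odd if and only if $n=\frac{m(5m-3)}{2}$ for some $m\in\mathbb{Z}$; (ii) $b_2(n)$ is odd if and only if $n=\frac{m(5m+1)}{2}-1$ or $n=\frac{m(5m-3)}{2}-1$ for some $m\in\mathbb{Z}$. -/

import Mathlib

/-- `nonRascoe ℓ n` is `b_ℓ(n)`: the number of partitions of `n` into distinct parts for which
the number of parts plus `ℓ` is not a part. For `n = 0` the empty partition is counted. -/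
def nonRascoe (ℓ n : ℕ) : ℕ :=
  Fintype.card {π : Nat.Partition n //
    π.parts.Nodup ∧ Multiset.card π.parts + ℓ ∉ π.parts}

/-- `boxPartitions N M k` is `p(N, M, k)`: the number of partitions of `k` into at most `M` parts,
each at most `N`. As the indices may be negative, a convention is needed: a partition with at most
`M` parts is read as a weakly decreasing sequence of `M` integers in `[0, N]` (pad with zeros).
So there is none if `M < 0`, and none if `M > 0` and `N < 0` (this is what the clause
`0 < M → 0 ≤ N` says), while for `M = 0` exactly the empty partition is left, whatever `N` is. -/
def boxPartitions (N M : ℤ) (k : ℕ) : ℕ :=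
  Fintype.card {π : Nat.Partition k //
    (Multiset.card π.parts : ℤ) ≤ M ∧ (∀ i ∈ π.parts, (i : ℤ) ≤ N) ∧ (0 < M → 0 ≤ N)}

/-- The generating function `∑_{n ≥ 0} b_ℓ(n) q^n`, as a formal Laurent series in `q`. -/
noncomputable def nonRascoeGenFun (ℓ : ℕ) : LaurentSeries ℤ :=
  HahnSeries.ofPowerSeries ℤ ℤ (PowerSeries.mk fun n => (nonRascoe ℓ n : ℤ))

/-- The coefficient attached to the index `(j, m, k)` of the triple sum:
`p(ℓ-1-⌊(ℓ+1-5j)/2⌋, ⌊(ℓ+1-5j)/2⌋, k) + p(ℓ-1-⌊(ℓ-1-5m)/2⌋, ⌊(ℓ-1-5m)/2⌋, k)`. -/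
def thetaCoeff (ℓ : ℕ) (j m : ℤ) (k : ℕ) : ℕ :=
  boxPartitions (ℓ - 1 - ⌊((ℓ + 1 - 5 * j : ℤ) : ℚ) / 2⌋) ⌊((ℓ + 1 - 5 * j : ℤ) : ℚ) / 2⌋ k +
  boxPartitions (ℓ - 1 - ⌊((ℓ - 1 - 5 * m : ℤ) : ℚ) / 2⌋) ⌊((ℓ - 1 - 5 * m : ℤ) : ℚ) / 2⌋ k

/-- The exponent `j(5j-3)/2 + m(5m+1)/2 - ℓ(ℓ-1)/2 + k` of `q` at the index `(j, m, k)`; the three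
numerators are even, so the integer divisions are exact. -/
def thetaExponent (ℓ : ℕ) (j m : ℤ) (k : ℕ) : ℤ :=
  j * (5 * j - 3) / 2 + m * (5 * m + 1) / 2 - (ℓ : ℤ) * ((ℓ : ℤ) - 1) / 2 + k

/-!
Write `B_ℓ` for the generating function of `b_ℓ`, modulo 2. Everything rests on the recurrence
`B_ℓ = B_{ℓ+1} + q^(ℓ+1) B_{ℓ+2}`, which has a bijective proof (`even_nonRascoe_recurrence`).
Since `B_ℓ` tends to `∏ (1 + q^i) ≡ ∏ (1 - q^i)` as `ℓ → ∞`, the recurrence determines all `B_ℓ`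
(`dvd_of_recurrence`).

The Rogers–Ramanujan series
`∑ₙ (-1)^n q^(2ℓn + n(5n+1)/2) (1 - q^(2ℓ+4n+2)) ∏_{1 ≤ i ≤ ℓ} (1 - q^(n+i))` satisfies the same recurrence, by telescoping (`sum_rrTerm_recurrence`), and has the same
limit. Hence it agrees with `B_ℓ` modulo 2. At `ℓ = 0` and `ℓ = 1` it collapses to theta series, so
`B_0 ≡ ∑ₘ q^(m(5m+1)/2)` and `B_1 ≡ ∑ⱼ q^(j(5j-3)/2)`. This is the assertion on `b_1`, and together
with `q B_2 ≡ B_0 + B_1` it gives the one on `b_2`, since the two sets of exponents meet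
only in `0`.

For general `ℓ` the recurrence is solved in terms of `B_0` and `B_1`:
`q^(ℓ(ℓ-1)/2) B_ℓ ≡ c_ℓ B_0 + d_ℓ B_1`, where `c_ℓ` and `d_ℓ` satisfy `x_{ℓ+2} = x_{ℓ+1} + q^ℓ x_ℓ`. These are Schur's
polynomials, alternating sums of Gaussian binomial coefficients; the recurrence for the sums follows
from the two `q`-Pascal rules (`schurSeries_recurrence`). Their generating function interpretation
as partitions in a box turns the product into the triple sum (`X_pow_mul_nonRascoeSeries`,
`coeff_nonRascoeGenFun_modEq`).

Infinite sums are handled through finite partial sums and congruences modulo `q^N`, and the sums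
over `ℤ` are cut off at `|j| ≤ K`.
-/

/-! ### The truncated Rogers–Ramanujan series and its recurrence -/

section QSeries

variable {R : Type*} [CommRing R]

/-- The summand `(-1)^n q^(2ℓn + n(5n+1)/2) (1 - q^(2ℓ+4n+2)) (1 - q^(n+1)) ⋯ (1 - q^(n+ℓ))`. Summed
over `n`, it is the classical series that equals `(q)_∞ ∑ q^(n² + ℓn) / (q)_n`; its recurrence
in `ℓ`, its limit as `ℓ → ∞` and its values at `ℓ = 0` and `ℓ = 1` are all that matters here. -/
def rrTerm (q : R) (ℓ n : ℕ) : R :=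
  (-1) ^ n * q ^ (2 * ℓ * n + n * (5 * n + 1) / 2) * (1 - q ^ (2 * ℓ + 4 * n + 2)) *
    ∏ i ∈ Finset.range ℓ, (1 - q ^ (n + 1 + i))

/-- Multiplication by `1 - q ^ (n + 1)` turns the product belonging to `n + 1` into a multiple of
the product belonging to `n`. This replaces a division in the telescoping argument. -/
theorem one_sub_pow_mul_prod_succ (q : R) (ℓ n : ℕ) :
    (1 - q ^ (n + 1)) * ∏ i ∈ Finset.range ℓ, (1 - q ^ (n + 1 + 1 + i)) =
      (∏ i ∈ Finset.range ℓ, (1 - q ^ (n + 1 + i))) * (1 - q ^ (n + 1 + ℓ)) := by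
  rw [← Finset.prod_range_succ (fun i => 1 - q ^ (n + 1 + i)), Finset.prod_range_succ', mul_comm]
  simp only [add_zero]
  congr 1
  exact Finset.prod_congr rfl fun i _ => by rw [add_assoc (n + 1), add_comm 1 i]

theorem pentagonal_exponent_succ (n : ℕ) :
    (n + 1) * (5 * (n + 1) + 1) / 2 = n * (5 * n + 1) / 2 + (5 * n + 3) := by
  rw [show (n + 1) * (5 * (n + 1) + 1) = n * (5 * n + 1) + 2 * (5 * n + 3) by ring]
  omega

/-- The recurrence `Y ℓ = Y (ℓ + 1) + q ^ (ℓ + 1) * Y (ℓ + 2)` holds for the partial sums of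
`rrTerm` up to an explicit boundary term: the summands on the left are the successive differences of
the right side, which vanishes at `N = 0`. -/
theorem sum_rrTerm_recurrence (q : R) (ℓ N : ℕ) :
    ∑ n ∈ Finset.range N, (rrTerm q ℓ n - rrTerm q (ℓ + 1) n - q ^ (ℓ + 1) * rrTerm q (ℓ + 2) n) =
      (-1) ^ N * q ^ (2 * ℓ * N + N * (5 * N + 1) / 2) * (1 - q ^ N) *
        (∏ i ∈ Finset.range ℓ, (1 - q ^ (N + 1 + i))) *
        (-(1 + q ^ N) - q ^ (ℓ + 1 + 3 * N) + q ^ (2 * ℓ + 2 + 4 * N)) := by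
  induction N with
  | zero => simp
  | succ N ih =>
    rw [Finset.sum_range_succ, ih, pentagonal_exponent_succ]
    have h := one_sub_pow_mul_prod_succ q ℓ N
    simp only [rrTerm, Finset.prod_range_succ]
    generalize ∏ i ∈ Finset.range ℓ, (1 - q ^ (N + 1 + 1 + i)) = P' at h ⊢
    generalize ∏ i ∈ Finset.range ℓ, (1 - q ^ (N + 1 + i)) = P at h ⊢
    generalize N * (5 * N + 1) / 2 = e
    linear_combination -((-1) ^ (N + 1) * q ^ (2 * ℓ * (N + 1) + (e + (5 * N + 3))) *
      (-(1 + q ^ (N + 1)) - q ^ (ℓ + 1 + 3 * (N + 1)) + q ^ (2 * ℓ + 2 + 4 * (N + 1)))) * h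

/-- At `ℓ = 0` the truncated series is a theta sum with exponents `m (5 m + 1) / 2`. -/
theorem sum_rrTerm_zero (q : R) (N : ℕ) :
    ∑ n ∈ Finset.range N, rrTerm q 0 n = ∑ n ∈ Finset.range N,
      ((-1) ^ n * q ^ (n * (5 * n + 1) / 2) +
        (-1) ^ (n + 1) * q ^ ((n + 1) * (5 * n + 4) / 2)) := by
  refine Finset.sum_congr rfl fun n _ => ?_
  have h : (n + 1) * (5 * n + 4) / 2 = n * (5 * n + 1) / 2 + (4 * n + 2) := by
    rw [show (n + 1) * (5 * n + 4) = n * (5 * n + 1) + 2 * (4 * n + 2) by ring]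
    omega
  rw [h, rrTerm, Finset.prod_range_zero]
  ring

/-- At `ℓ = 1` the factor `1 - q ^ (n + 1)` splits each term in four, of which two telescope; what
remains is a theta sum with exponents `m (5 m - 3) / 2`, up to one boundary term. -/
theorem sum_rrTerm_one (q : R) (N : ℕ) :
    ∑ n ∈ Finset.range N, rrTerm q 1 n = 1 - (-1) ^ N * q ^ (5 * (N * (N + 1) / 2)) +
      ∑ n ∈ Finset.range N, (-1) ^ (n + 1) *
        (q ^ ((n + 1) * (5 * n + 2) / 2) + q ^ ((n + 1) * (5 * n + 8) / 2)) := by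
  induction N with
  | zero => simp
  | succ N ih =>
    have h1 : N * (5 * N + 1) / 2 + 2 * N = 5 * (N * (N + 1) / 2) := by
      have : N * (5 * N + 1) + 2 * (2 * N) = 5 * (N * (N + 1)) := by ring
      have := Nat.even_mul_succ_self N
      grind
    have h2 : (N + 1) * (5 * N + 2) / 2 = 5 * (N * (N + 1) / 2) + (N + 1) := by
      have : (N + 1) * (5 * N + 2) = 5 * (N * (N + 1)) + 2 * (N + 1) := by ring
      have := Nat.even_mul_succ_self N
      grind
    have h3 : (N + 1) * (5 * N + 8) / 2 = 5 * (N * (N + 1) / 2) + 4 * (N + 1) := by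
      have : (N + 1) * (5 * N + 8) = 5 * (N * (N + 1)) + 2 * (4 * (N + 1)) := by ring
      have := Nat.even_mul_succ_self N
      grind
    have h4 : (N + 1) * (N + 1 + 1) / 2 = N * (N + 1) / 2 + (N + 1) := by
      rw [show (N + 1) * (N + 1 + 1) = N * (N + 1) + 2 * (N + 1) by ring]
      omega
    rw [Finset.sum_range_succ, ih, Finset.sum_range_succ, h2, h3, h4, rrTerm]
    rw [show 2 * 1 * N + N * (5 * N + 1) / 2 = 5 * (N * (N + 1) / 2) by omega]
    generalize N * (N + 1) / 2 = e
    simp only [Finset.prod_range_one]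
    ring

end QSeries

/-! ### Solutions of the recurrence are determined by their limit -/

section Uniqueness

variable {R : Type*} [CommRing R]

/-- If `D` satisfies the recurrence modulo `q ^ N` and vanishes modulo `q ^ N` for `N ≤ ℓ`, then it
vanishes modulo `q ^ N` everywhere: the recurrence is run downwards from `ℓ = N`. -/
theorem dvd_of_recurrence {q : R} {N : ℕ} {D : ℕ → R}
    (hrec : ∀ ℓ, q ^ N ∣ D ℓ - D (ℓ + 1) - q ^ (ℓ + 1) * D (ℓ + 2))
    (hlim : ∀ ℓ, N ≤ ℓ → q ^ N ∣ D ℓ) (ℓ : ℕ) : q ^ N ∣ D ℓ := by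
  suffices h : ∀ k ℓ, N ≤ ℓ + k → q ^ N ∣ D ℓ from h N ℓ (Nat.le_add_left _ _)
  intro k
  induction k using Nat.strong_induction_on with
  | _ k ih =>
    intro ℓ hℓ
    by_cases hk : N ≤ ℓ
    · exact hlim ℓ hk
    have h1 := ih (k - 1) (by omega) (ℓ + 1) (by omega)
    have h2 := ih (k - 1) (by omega) (ℓ + 2) (by omega)
    have h := dvd_add (dvd_add (hrec ℓ) h1) (h2.mul_left (q ^ (ℓ + 1)))
    ring_nf at h
    exact h

theorem pow_dvd_sum_rrTerm_recurrence (q : R) (ℓ N : ℕ) :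
    q ^ N ∣ ∑ n ∈ Finset.range N, rrTerm q ℓ n - ∑ n ∈ Finset.range N, rrTerm q (ℓ + 1) n -
      q ^ (ℓ + 1) * ∑ n ∈ Finset.range N, rrTerm q (ℓ + 2) n := by
  rw [Finset.mul_sum, ← Finset.sum_sub_distrib, ← Finset.sum_sub_distrib, sum_rrTerm_recurrence]
  have h : N ≤ 2 * ℓ * N + N * (5 * N + 1) / 2 := by
    have : 2 * N ≤ N * (5 * N + 1) := by nlinarith [Nat.le_mul_self N]
    omega
  exact (((pow_dvd_pow q h).mul_left _).mul_right _ |>.mul_right _).mul_right _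

theorem pow_dvd_sum_rrTerm_sub_prod (q : R) {ℓ N : ℕ} (h : N ≤ ℓ) :
    q ^ N ∣ ∑ n ∈ Finset.range N, rrTerm q ℓ n - ∏ i ∈ Finset.range ℓ, (1 - q ^ (i + 1)) := by
  rcases N with _ | N
  · simp
  rw [Finset.sum_range_succ', add_sub_assoc]
  refine dvd_add (Finset.dvd_sum fun n _ => ?_) ?_
  · refine (((pow_dvd_pow q ?_).mul_left _).mul_right _).mul_right _
    nlinarith [Nat.zero_le ((n + 1) * (5 * (n + 1) + 1) / 2), Nat.zero_le (ℓ * n)]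
  · have : rrTerm q ℓ 0 - ∏ i ∈ Finset.range ℓ, (1 - q ^ (i + 1)) =
        q ^ (2 * ℓ + 2) * -∏ i ∈ Finset.range ℓ, (1 - q ^ (i + 1)) := by
      simp only [rrTerm, zero_add, add_comm 1]
      ring_nf
    rw [this]
    exact (pow_dvd_pow q (by omega)).mul_right _

end Uniqueness

/-! ### Partitions into distinct parts -/

section DistinctPartitions

open Finset

/-- The finite sets of positive integers with sum `n`, that is, the partitions of `n` into distinct
parts. -/
def distinctSets (n : ℕ) : Finset (Finset ℕ) :=
  {S ∈ (range (n + 1)).powerset | 0 ∉ S ∧ ∑ i ∈ S, i = n}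

theorem mem_distinctSets {n : ℕ} {S : Finset ℕ} :
    S ∈ distinctSets n ↔ 0 ∉ S ∧ ∑ i ∈ S, i = n := by
  simp only [distinctSets, mem_filter, mem_powerset, and_iff_right_iff_imp]
  rintro ⟨-, rfl⟩ i hi
  exact mem_range_succ_iff.2 (single_le_sum (f := fun i => i) (fun _ _ => Nat.zero_le _) hi)

theorem nonRascoe_eq_card (ℓ n : ℕ) :
    nonRascoe ℓ n = #{S ∈ distinctSets n | #S + ℓ ∉ S} := by
  rw [nonRascoe, Fintype.card_subtype]
  refine card_bij (fun π _ => π.parts.toFinset) ?_ ?_ ?_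
  · intro π hπ
    simp only [mem_filter, mem_univ, true_and] at hπ
    obtain ⟨hnd, hnot⟩ := hπ
    simp only [mem_filter, mem_distinctSets, Multiset.mem_toFinset,
      Multiset.toFinset_card_of_nodup hnd]
    refine ⟨⟨fun h => (π.parts_pos h).ne rfl, ?_⟩, hnot⟩
    rw [sum_eq_multiset_sum, Multiset.toFinset_val, hnd.dedup, Multiset.map_id', π.parts_sum]
  · intro π hπ π' hπ' h
    simp only [mem_filter, mem_univ, true_and] at hπ hπ'
    have := congrArg Finset.val h
    simp only [Multiset.toFinset_val, hπ.1.dedup, hπ'.1.dedup] at this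
    exact Nat.Partition.ext this
  · intro S hS
    simp only [mem_filter, mem_distinctSets] at hS
    obtain ⟨⟨h0, hsum⟩, hnot⟩ := hS
    refine ⟨⟨S.val, fun {i} hi => Nat.pos_of_ne_zero fun h => h0 (h ▸ hi), ?_⟩, ?_, ?_⟩
    · rw [← hsum, sum_eq_multiset_sum, Multiset.map_id']
    · simpa only [mem_filter, mem_univ, true_and] using ⟨S.nodup, hnot⟩
    · simp

theorem nonRascoe_eq_card_of_le {ℓ n : ℕ} (h : n ≤ ℓ) : nonRascoe ℓ n = #(distinctSets n) := by
  rw [nonRascoe_eq_card, filter_true_of_mem]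
  intro S hS hmem
  obtain ⟨h0, hsum⟩ := mem_distinctSets.1 hS
  have h1 := single_le_sum (f := fun i => i) (fun _ _ => Nat.zero_le _) hmem
  have h2 := card_pos.2 ⟨_, hmem⟩
  omega

theorem sum_map_succ (S : Finset ℕ) : ∑ i ∈ S.map (addRightEmbedding 1), i = ∑ i ∈ S, i + #S := by
  simp [sum_map, sum_add_distrib]

theorem exists_eq_map_succ {S : Finset ℕ} (h : 0 ∉ S) :
    ∃ T : Finset ℕ, S = T.map (addRightEmbedding 1) := by
  refine ⟨S.image (· - 1), ?_⟩
  ext i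
  simp only [mem_map, mem_image, addRightEmbedding_apply]
  constructor
  · intro hi
    have : i ≠ 0 := fun h' => h (h' ▸ hi)
    exact ⟨i - 1, ⟨i, hi, rfl⟩, by omega⟩
  · rintro ⟨_, ⟨j, hj, rfl⟩, rfl⟩
    have : j ≠ 0 := fun h' => h (h' ▸ hj)
    rwa [Nat.sub_add_cancel (by omega)]

/-- Delete the part `#S + ℓ` and add one to each remaining part. -/
theorem card_delete_shift (ℓ m : ℕ) :
    #{S ∈ distinctSets (m + ℓ + 1) | #S + ℓ ∈ S ∧ #S + ℓ + 1 ∉ S} =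
      #{S ∈ distinctSets m | 1 ∉ S ∧ #S + ℓ + 2 ∉ S ∧ #S + ℓ + 3 ∉ S} := by
  refine card_bij (fun S _ => (S.erase (#S + ℓ)).map (addRightEmbedding 1)) ?_ ?_ ?_
  · intro S hS
    simp only [mem_filter, mem_distinctSets] at hS ⊢
    obtain ⟨⟨h0, hsum⟩, h1, h2⟩ := hS
    have hc := card_erase_add_one h1
    have hs := add_sum_erase S (fun i => i) h1
    rw [sum_map_succ, card_map]
    simp only [mem_map, addRightEmbedding_apply, mem_erase]
    refine ⟨⟨by grind, by omega⟩, by grind, by grind, by grind⟩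
  · intro S hS T hT h
    simp only [mem_filter, mem_distinctSets] at hS hT
    obtain ⟨⟨h0, hsum⟩, h1, h2⟩ := hS
    obtain ⟨⟨h0', hsum'⟩, h1', h2'⟩ := hT
    have h := map_injective _ h
    have hc := card_erase_add_one h1
    have hc' := card_erase_add_one h1'
    have : #S = #T := by rw [← hc, ← hc', h]
    rw [← insert_erase h1, ← insert_erase h1', h, this]
  · intro V hV
    simp only [mem_filter, mem_distinctSets] at hV
    obtain ⟨⟨h0, hsum⟩, h1, h2, h3⟩ := hV
    obtain ⟨T, rfl⟩ := exists_eq_map_succ h0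
    rw [sum_map_succ] at hsum
    simp only [mem_map, addRightEmbedding_apply, card_map] at h0 h1 h2 h3
    have hT : #T + 1 + ℓ ∉ T := by grind
    have hc : #(insert (#T + 1 + ℓ) T) = #T + 1 := card_insert_of_notMem hT
    refine ⟨insert (#T + 1 + ℓ) T, ?_, ?_⟩
    · simp only [mem_filter, mem_distinctSets, sum_insert hT, hc, mem_insert]
      refine ⟨⟨by grind, by omega⟩, by grind, by grind⟩
    · simp only [hc, erase_insert hT]

/-- Delete the part `#S + ℓ + 1`, add one to each remaining part, and insert the part `1`. -/
theorem card_delete_shift_insert (ℓ m : ℕ) :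
    #{S ∈ distinctSets (m + ℓ + 1) | #S + ℓ ∉ S ∧ #S + ℓ + 1 ∈ S} =
      #{S ∈ distinctSets m | 1 ∈ S ∧ #S + ℓ + 1 ∉ S ∧ #S + ℓ + 2 ∉ S} := by
  refine card_bij
    (fun S _ => insert 1 ((S.erase (#S + ℓ + 1)).map (addRightEmbedding 1))) ?_ ?_ ?_
  · intro S hS
    simp only [mem_filter, mem_distinctSets] at hS ⊢
    obtain ⟨⟨h0, hsum⟩, h1, h2⟩ := hS
    have hc := card_erase_add_one h2
    have hs := add_sum_erase S (fun i => i) h2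
    have hn : 1 ∉ (S.erase (#S + ℓ + 1)).map (addRightEmbedding 1) := by
      simp only [mem_map, addRightEmbedding_apply, mem_erase]
      grind
    rw [sum_insert hn, card_insert_of_notMem hn, sum_map_succ, card_map]
    simp only [mem_insert, mem_map, addRightEmbedding_apply, mem_erase]
    refine ⟨⟨by grind, by omega⟩, by grind, by grind, by grind⟩
  · intro S hS T hT h
    simp only [mem_filter, mem_distinctSets] at hS hT
    obtain ⟨⟨h0, hsum⟩, h1, h2⟩ := hS
    obtain ⟨⟨h0', hsum'⟩, h1', h2'⟩ := hT
    have hn : 1 ∉ (S.erase (#S + ℓ + 1)).map (addRightEmbedding 1) := by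
      simp only [mem_map, addRightEmbedding_apply, mem_erase]
      grind
    have hn' : 1 ∉ (T.erase (#T + ℓ + 1)).map (addRightEmbedding 1) := by
      simp only [mem_map, addRightEmbedding_apply, mem_erase]
      grind
    have h := congrArg (fun U => erase U 1) h
    simp only [erase_insert hn, erase_insert hn'] at h
    have h := map_injective _ h
    have hc := card_erase_add_one h2
    have hc' := card_erase_add_one h2'
    have : #S = #T := by rw [← hc, ← hc', h]
    rw [← insert_erase h2, ← insert_erase h2', h, this]
  · intro V hV
    simp only [mem_filter, mem_distinctSets] at hV
    obtain ⟨⟨h0, hsum⟩, h1, h2, h3⟩ := hV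
    obtain ⟨T, hVT⟩ := exists_eq_map_succ (S := V.erase 1) (by grind)
    have hc := card_erase_add_one h1
    have hs := add_sum_erase V (fun i => i) h1
    have hmem : ∀ i, i ∈ T ↔ i + 1 ∈ V.erase 1 := by intro i; simp [hVT]
    rw [hVT, sum_map_succ] at hs
    rw [hVT, card_map] at hc
    simp only [mem_erase] at hmem
    have hT : #T + 1 + ℓ + 1 ∉ T := by grind
    have hc' : #(insert (#T + 1 + ℓ + 1) T) = #T + 1 := card_insert_of_notMem hT
    refine ⟨insert (#T + 1 + ℓ + 1) T, ?_, ?_⟩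
    · simp only [mem_filter, mem_distinctSets, sum_insert hT, hc', mem_insert]
      refine ⟨⟨by grind, by omega⟩, by grind, by grind⟩
    · simp only [hc', erase_insert hT, ← hVT, insert_erase h1]

/-- Split the part `#S + ℓ + 3` into `#S + ℓ + 2` and `1`. -/
theorem card_exchange_one (ℓ m : ℕ) :
    #{S ∈ distinctSets m | 1 ∉ S ∧ #S + ℓ + 2 ∉ S ∧ #S + ℓ + 3 ∈ S} =
      #{S ∈ distinctSets m | 1 ∈ S ∧ #S + ℓ + 2 ∉ S ∧ #S + ℓ + 1 ∈ S} := by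
  refine card_nbij' (fun S => insert 1 (insert (#S + ℓ + 2) (S.erase (#S + ℓ + 3))))
    (fun S => insert (#S + ℓ + 2) ((S.erase 1).erase (#S + ℓ + 1))) ?_ ?_ ?_ ?_
  · intro S hS
    simp only [coe_filter, Set.mem_ofPred_eq, mem_distinctSets] at hS ⊢
    obtain ⟨⟨h0, hsum⟩, h1, h2, h3⟩ := hS
    have hs := add_sum_erase S (fun i => i) h3
    have hc := card_erase_add_one h3
    have hn : #S + ℓ + 2 ∉ S.erase (#S + ℓ + 3) := by grind
    have hn' : 1 ∉ insert (#S + ℓ + 2) (S.erase (#S + ℓ + 3)) := by grind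
    rw [sum_insert hn', card_insert_of_notMem hn', sum_insert hn, card_insert_of_notMem hn]
    grind
  · intro S hS
    simp only [coe_filter, Set.mem_ofPred_eq, mem_distinctSets] at hS ⊢
    obtain ⟨⟨h0, hsum⟩, h1, h2, h3⟩ := hS
    have hp := card_pos.2 ⟨_, h1⟩
    have h3' : #S + ℓ + 1 ∈ S.erase 1 := by grind
    have hs := add_sum_erase S (fun i => i) h1
    have hc := card_erase_add_one h1
    have hs' := add_sum_erase _ (fun i => i) h3'
    have hc' := card_erase_add_one h3'
    have hn : #S + ℓ + 2 ∉ (S.erase 1).erase (#S + ℓ + 1) := by grind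
    rw [sum_insert hn, card_insert_of_notMem hn]
    grind
  · intro S hS
    simp only [coe_filter, Set.mem_ofPred_eq, mem_distinctSets] at hS ⊢
    obtain ⟨⟨h0, hsum⟩, h1, h2, h3⟩ := hS
    have hc := card_erase_add_one h3
    have hn : #S + ℓ + 2 ∉ S.erase (#S + ℓ + 3) := by grind
    have hn' : 1 ∉ insert (#S + ℓ + 2) (S.erase (#S + ℓ + 3)) := by grind
    rw [card_insert_of_notMem hn', card_insert_of_notMem hn]
    grind
  · intro S hS
    simp only [coe_filter, Set.mem_ofPred_eq, mem_distinctSets] at hS ⊢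
    obtain ⟨⟨h0, hsum⟩, h1, h2, h3⟩ := hS
    have hp := card_pos.2 ⟨_, h1⟩
    have h3' : #S + ℓ + 1 ∈ S.erase 1 := by grind
    have hc := card_erase_add_one h1
    have hc' := card_erase_add_one h3'
    have hn : #S + ℓ + 2 ∉ (S.erase 1).erase (#S + ℓ + 1) := by grind
    rw [card_insert_of_notMem hn]
    grind

theorem card_filter_eq_add_card_filter_not {α : Type*} (s : Finset α) (p q : α → Prop)
    [DecidablePred p] [DecidablePred q] :
    #{x ∈ s | p x} = #{x ∈ s | p x ∧ q x} + #{x ∈ s | p x ∧ ¬q x} := by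
  rw [← card_filter_add_card_filter_not (s := {x ∈ s | p x}) q, filter_filter, filter_filter]

/-- The combinatorial recurrence `b_ℓ(n) ≡ b_{ℓ+1}(n) + b_{ℓ+2}(n - ℓ - 1)` modulo 2. Sets that
avoid both `#S + ℓ` and `#S + ℓ + 1` are counted twice; the sets containing exactly one of the two
correspond to those counted by `nonRascoe (ℓ + 2) m`, except for two classes of equal size. -/
theorem even_nonRascoe_recurrence (ℓ m : ℕ) :
    Even (nonRascoe ℓ (m + ℓ + 1) + nonRascoe (ℓ + 1) (m + ℓ + 1) + nonRascoe (ℓ + 2) m) := by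
  have e1 : nonRascoe ℓ (m + ℓ + 1) =
      #{S ∈ distinctSets (m + ℓ + 1) | #S + ℓ ∉ S ∧ #S + ℓ + 1 ∈ S} +
      #{S ∈ distinctSets (m + ℓ + 1) | #S + ℓ ∉ S ∧ #S + ℓ + 1 ∉ S} := by
    rw [nonRascoe_eq_card]
    exact card_filter_eq_add_card_filter_not _ _ _
  have e2 : nonRascoe (ℓ + 1) (m + ℓ + 1) =
      #{S ∈ distinctSets (m + ℓ + 1) | #S + ℓ ∈ S ∧ #S + ℓ + 1 ∉ S} +
      #{S ∈ distinctSets (m + ℓ + 1) | #S + ℓ ∉ S ∧ #S + ℓ + 1 ∉ S} := by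
    rw [nonRascoe_eq_card, card_filter_eq_add_card_filter_not _ _ (fun S => #S + ℓ ∈ S)]
    simp only [and_comm, add_assoc]
  have e3 : nonRascoe (ℓ + 2) m =
      #{S ∈ distinctSets m | 1 ∈ S ∧ #S + ℓ + 2 ∉ S ∧ #S + ℓ + 1 ∈ S} +
      #{S ∈ distinctSets m | 1 ∈ S ∧ #S + ℓ + 1 ∉ S ∧ #S + ℓ + 2 ∉ S} +
      (#{S ∈ distinctSets m | 1 ∉ S ∧ #S + ℓ + 2 ∉ S ∧ #S + ℓ + 3 ∈ S} +
      #{S ∈ distinctSets m | 1 ∉ S ∧ #S + ℓ + 2 ∉ S ∧ #S + ℓ + 3 ∉ S}) := by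
    rw [nonRascoe_eq_card, card_filter_eq_add_card_filter_not _ _ (fun S => 1 ∈ S),
      card_filter_eq_add_card_filter_not _ _ (fun S => #S + ℓ + 1 ∈ S),
      card_filter_eq_add_card_filter_not _ (fun S => _ ∧ 1 ∉ S) (fun S => #S + ℓ + 3 ∈ S)]
    congr 3 <;> exact filter_congr fun S _ => by simp only [add_assoc]; tauto
  rw [e1, e2, e3, card_delete_shift, card_delete_shift_insert, card_exchange_one]
  grind

end DistinctPartitions

/-! ### The generating function modulo 2 -/

section GeneratingFunction

open PowerSeries Finset

/-- The generating function of `nonRascoe ℓ`, reduced modulo 2. -/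
noncomputable def nonRascoeSeries (ℓ : ℕ) : (ZMod 2)⟦X⟧ :=
  PowerSeries.mk fun n => (nonRascoe ℓ n : ZMod 2)

theorem powerSeries_add_self (f : (ZMod 2)⟦X⟧) : f + f = 0 := by
  ext n
  simp [CharTwo.add_self_eq_zero]

/-- For `n ≤ ℓ` the condition on the number of parts is void, so that the coefficients not covered
by `even_nonRascoe_recurrence` agree on both sides. -/
theorem nonRascoeSeries_recurrence (ℓ : ℕ) :
    nonRascoeSeries ℓ = nonRascoeSeries (ℓ + 1) + X ^ (ℓ + 1) * nonRascoeSeries (ℓ + 2) := by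
  ext n
  rw [map_add, coeff_X_pow_mul']
  simp only [nonRascoeSeries, coeff_mk]
  split_ifs with h
  · obtain ⟨m, rfl⟩ := Nat.exists_eq_add_of_le h
    have := even_nonRascoe_recurrence ℓ m
    rw [show m + ℓ + 1 = ℓ + 1 + m by ring] at this
    have := (ZMod.natCast_eq_zero_iff_even).2 this
    push_cast at this
    rw [Nat.add_sub_cancel_left, ← sub_eq_zero, ← this]
    simp only [CharTwo.sub_eq_add]
    ring
  · rw [nonRascoe_eq_card_of_le (by omega : n ≤ ℓ), nonRascoe_eq_card_of_le (by omega : n ≤ ℓ + 1),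
      add_zero]

/-- For `n < N ≤ ℓ` the coefficient counts all partitions of `n` into distinct parts, with
generating function `∏ (1 + q ^ i) ≡ ∏ (1 - q ^ i)`. -/
theorem X_pow_dvd_nonRascoeSeries_sub_prod {ℓ N : ℕ} (h : N ≤ ℓ) :
    X ^ N ∣ nonRascoeSeries ℓ - ∏ i ∈ range ℓ, (1 - X ^ (i + 1)) := by
  rw [X_pow_dvd_iff]
  intro n hn
  have hneg : ∀ i ∈ range ℓ, (1 - X ^ (i + 1) : (ZMod 2)⟦X⟧) = 1 + X ^ (i + 1) := fun i _ => by
    rw [sub_eq_add_neg, neg_eq_of_add_eq_zero_left (powerSeries_add_self _)]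
  have hcard : #(distinctSets n) = #{T ∈ (range ℓ).powerset | n = ∑ i ∈ T, (i + 1)} := by
    symm
    refine card_bij (fun T _ => T.map (addRightEmbedding 1)) ?_ ?_ ?_
    · intro T hT
      rw [mem_filter] at hT
      rw [mem_distinctSets]
      simp [hT.2]
    · intro T _ T' _ h
      exact map_injective _ h
    · intro S hS
      obtain ⟨h0, hsum⟩ := mem_distinctSets.1 hS
      obtain ⟨T, rfl⟩ := exists_eq_map_succ h0
      refine ⟨T, ?_, rfl⟩
      rw [mem_filter, mem_powerset]
      simp only [sum_map, addRightEmbedding_apply] at hsum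
      refine ⟨fun i hi => mem_range.2 ?_, hsum.symm⟩
      have := single_le_sum (f := fun i => i + 1) (fun _ _ => Nat.zero_le _) hi
      omega
  rw [prod_congr rfl hneg, map_sub, nonRascoeSeries, coeff_mk,
    nonRascoe_eq_card_of_le (by omega), prod_one_add, map_sum, sub_eq_zero, hcard]
  simp only [prod_pow_eq_pow_sum, coeff_X_pow, sum_boole]

/-- Both sides satisfy the same recurrence modulo `q ^ N` and agree for `N ≤ ℓ`. -/
theorem X_pow_dvd_nonRascoeSeries_sub_sum_rrTerm (N ℓ : ℕ) :
    X ^ N ∣ nonRascoeSeries ℓ - ∑ n ∈ range N, rrTerm X ℓ n := by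
  refine dvd_of_recurrence (D := fun ℓ => nonRascoeSeries ℓ - ∑ n ∈ range N, rrTerm X ℓ n)
    (fun ℓ => ?_) (fun ℓ hℓ => ?_) ℓ
  · have h := (pow_dvd_sum_rrTerm_recurrence (X : (ZMod 2)⟦X⟧) ℓ N).neg_right
    convert h using 1
    simp only [nonRascoeSeries_recurrence ℓ]
    ring
  · have h := dvd_sub (X_pow_dvd_nonRascoeSeries_sub_prod hℓ)
      (pow_dvd_sum_rrTerm_sub_prod (X : (ZMod 2)⟦X⟧) hℓ)
    simpa using h

end GeneratingFunction

/-! ### Theta series -/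

section Theta

open PowerSeries Finset

/-- The exponent `j (5 j + 1 - 2 c) / 2` of a theta series, used for `c = 0` and `c = 2` only. It is
then a nonnegative integer, so that neither the division nor the truncation loses anything. -/
def thetaExp (c j : ℤ) : ℕ := (j * (5 * j + 1 - 2 * c) / 2).toNat

theorem two_dvd_thetaExp_numerator (c j : ℤ) : 2 ∣ j * (5 * j + 1 - 2 * c) := by
  rcases Int.even_or_odd' j with ⟨k, rfl | rfl⟩
  · exact ⟨k * (5 * (2 * k) + 1 - 2 * c), by ring⟩
  · exact ⟨(2 * k + 1) * (5 * k + 3 - c), by ring⟩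

theorem two_mul_thetaExp {c : ℤ} (hc : c = 0 ∨ c = 2) (j : ℤ) :
    2 * (thetaExp c j : ℤ) = j * (5 * j + 1 - 2 * c) := by
  have h0 : 0 ≤ j * (5 * j + 1 - 2 * c) := by
    rcases le_or_gt j 0 with h | h
    · rcases h.eq_or_lt with rfl | h
      · simp
      · exact mul_nonneg_of_nonpos_of_nonpos h.le (by omega)
    · exact mul_nonneg h.le (by omega)
  rw [thetaExp, Int.toNat_of_nonneg (by omega)]
  exact Int.mul_ediv_cancel' (two_dvd_thetaExp_numerator c j)

theorem le_thetaExp {c : ℤ} (hc : c = 0 ∨ c = 2) (j : ℤ) : j.natAbs ≤ thetaExp c j := by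
  have h := two_mul_thetaExp hc j
  zify
  rcases le_or_gt j 0 with hj | hj
  · rw [abs_of_nonpos hj]
    rcases hc with rfl | rfl <;> nlinarith
  · rw [abs_of_pos hj]
    rcases hc with rfl | rfl <;> nlinarith

theorem sum_Icc_neg_self {M : Type*} [AddCommMonoid M] (f : ℤ → M) (N : ℕ) :
    ∑ j ∈ Icc (-N : ℤ) N, f j = f 0 + ∑ n ∈ range N, (f (n + 1) + f (-(n + 1))) := by
  induction N with
  | zero => simp
  | succ N ih =>
    have : Icc (-((N + 1 : ℕ) : ℤ)) ((N + 1 : ℕ) : ℤ) =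
        insert ((N : ℤ) + 1) (insert (-((N : ℤ) + 1)) (Icc (-N : ℤ) N)) := by
      ext i
      simp only [mem_insert, mem_Icc]
      omega
    rw [this, sum_insert, sum_insert, ih, sum_range_succ]
    · abel
    · simp
    · simp only [mem_insert, mem_Icc]
      omega

/-- The theta series `∑ j, q ^ (j (5 j + 1 - 2 c) / 2)` modulo 2, cut off at `|j| ≤ N`. -/
noncomputable def thetaPartial (c : ℤ) (N : ℕ) : (ZMod 2)⟦X⟧ :=
  ∑ j ∈ Icc (-N : ℤ) N, X ^ thetaExp c j

theorem neg_one_pow_powerSeries (n : ℕ) : (-1 : (ZMod 2)⟦X⟧) ^ n = 1 := by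
  rw [neg_eq_of_add_eq_zero_left (powerSeries_add_self 1), one_pow]

theorem X_pow_dvd_nonRascoeSeries_zero_sub_thetaPartial (N : ℕ) :
    X ^ N ∣ nonRascoeSeries 0 - thetaPartial 0 N := by
  have h := X_pow_dvd_nonRascoeSeries_sub_sum_rrTerm N 0
  have hsum : thetaPartial 0 N = ∑ n ∈ range N, rrTerm X 0 n + X ^ thetaExp 0 N := by
    rw [sum_rrTerm_zero, thetaPartial, sum_Icc_neg_self]
    simp only [neg_one_pow_powerSeries, one_mul, sum_add_distrib]
    have h1 : ∀ n : ℕ, n * (5 * n + 1) / 2 = thetaExp 0 n := fun n => by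
      have := two_mul_thetaExp (Or.inl rfl) (n : ℤ)
      have h : 2 * thetaExp 0 n = n * (5 * n + 1) := by zify; linarith
      omega
    have h2 : ∀ n : ℕ, (n + 1) * (5 * n + 4) / 2 = thetaExp 0 (-(n + 1)) := fun n => by
      have := two_mul_thetaExp (Or.inl rfl) (-((n : ℤ) + 1))
      have h : 2 * thetaExp 0 (-(n + 1)) = (n + 1) * (5 * n + 4) := by zify; linarith
      omega
    simp only [h1, h2]
    have := (sum_range_succ (fun n : ℕ => (X : (ZMod 2)⟦X⟧) ^ thetaExp 0 n) N).symm.trans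
      (sum_range_succ' _ _)
    push_cast at this
    linear_combination -this
  rw [hsum, ← sub_sub]
  exact dvd_sub h (pow_dvd_pow X (by simpa using le_thetaExp (Or.inl rfl) (N : ℤ)))

theorem X_pow_dvd_nonRascoeSeries_one_sub_thetaPartial (N : ℕ) :
    X ^ N ∣ nonRascoeSeries 1 - thetaPartial 2 N := by
  have h := X_pow_dvd_nonRascoeSeries_sub_sum_rrTerm N 1
  have hsum : ∑ n ∈ range N, rrTerm X 1 n = thetaPartial 2 N - X ^ (5 * (N * (N + 1) / 2)) := by
    rw [sum_rrTerm_one, thetaPartial, sum_Icc_neg_self]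
    simp only [neg_one_pow_powerSeries, one_mul]
    have h1 : ∀ n : ℕ, (n + 1) * (5 * n + 2) / 2 = thetaExp 2 (n + 1) := fun n => by
      have := two_mul_thetaExp (Or.inr rfl) ((n : ℤ) + 1)
      have h : 2 * thetaExp 2 (n + 1) = (n + 1) * (5 * n + 2) := by zify; linarith
      omega
    have h2 : ∀ n : ℕ, (n + 1) * (5 * n + 8) / 2 = thetaExp 2 (-(n + 1)) := fun n => by
      have := two_mul_thetaExp (Or.inr rfl) (-((n : ℤ) + 1))
      have h : 2 * thetaExp 2 (-(n + 1)) = (n + 1) * (5 * n + 8) := by zify; linarith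
      omega
    simp only [h1, h2]
    simp only [thetaExp, zero_mul, EuclideanDomain.zero_div, Int.toNat_zero, pow_zero]
    ring
  rw [hsum] at h
  have hN : N ≤ 5 * (N * (N + 1) / 2) := by
    have : 2 * (N * (N + 1) / 2) = N * (N + 1) :=
      Nat.mul_div_cancel' (Nat.even_mul_succ_self N).two_dvd
    nlinarith [Nat.le_mul_self N]
  have := dvd_sub h (pow_dvd_pow (X : (ZMod 2)⟦X⟧) hN)
  convert this using 1
  ring

end Theta

/-! ### The odd values for small shifts -/

section OddValues

open PowerSeries Finset

theorem thetaExp_injective {c : ℤ} (hc : c = 0 ∨ c = 2) : Function.Injective (thetaExp c) := by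
  intro i j h
  have hi := two_mul_thetaExp hc i
  have hj := two_mul_thetaExp hc j
  rw [h] at hi
  have hprod : (i - j) * (5 * (i + j) + 1 - 2 * c) = 0 := by linear_combination hj - hi
  rcases mul_eq_zero.1 hprod with h | h
  · omega
  · omega

open Classical in
theorem coeff_thetaPartial {c : ℤ} (hc : c = 0 ∨ c = 2) {n N : ℕ} (hn : n ≤ N) :
    coeff n (thetaPartial c N) = if ∃ j, thetaExp c j = n then 1 else 0 := by
  simp only [thetaPartial, map_sum, coeff_X_pow]
  split_ifs with h
  · obtain ⟨j, rfl⟩ := h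
    rw [sum_eq_single j]
    · simp
    · intro i _ hi
      exact if_neg fun h => hi (thetaExp_injective hc h).symm
    · intro hj
      have := le_thetaExp hc j
      exact absurd (mem_Icc.2 (by omega)) hj
  · exact sum_eq_zero fun j _ => if_neg fun h' => h ⟨j, h'.symm⟩

theorem odd_nonRascoe_iff_coeff (ℓ n : ℕ) :
    Odd (nonRascoe ℓ n) ↔ coeff n (nonRascoeSeries ℓ) = 1 := by
  rw [nonRascoeSeries, coeff_mk, ZMod.natCast_eq_one_iff_odd]

theorem coeff_eq_of_X_pow_dvd_sub {N n : ℕ} {f g : (ZMod 2)⟦X⟧} (h : X ^ N ∣ f - g) (hn : n < N) :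
    coeff n f = coeff n g := by
  simpa [sub_eq_zero] using X_pow_dvd_iff.1 h n hn

theorem odd_nonRascoe_zero_iff (n : ℕ) : Odd (nonRascoe 0 n) ↔ ∃ j, thetaExp 0 j = n := by
  classical
  rw [odd_nonRascoe_iff_coeff, coeff_eq_of_X_pow_dvd_sub
    (X_pow_dvd_nonRascoeSeries_zero_sub_thetaPartial (n + 1)) n.lt_succ_self,
    coeff_thetaPartial (Or.inl rfl) n.le_succ]
  simp

theorem odd_nonRascoe_one_iff (n : ℕ) : Odd (nonRascoe 1 n) ↔ ∃ j, thetaExp 2 j = n := by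
  classical
  rw [odd_nonRascoe_iff_coeff, coeff_eq_of_X_pow_dvd_sub
    (X_pow_dvd_nonRascoeSeries_one_sub_thetaPartial (n + 1)) n.lt_succ_self,
    coeff_thetaPartial (Or.inr rfl) n.le_succ]
  simp

/-- The two families of exponents share only the value `0`: with `d = j - i` and `s = i + j`, a
common value forces `(5 d - 2) (5 s - 1) = 2`. -/
theorem thetaExp_zero_eq_zero_of_eq {i j : ℤ} (h : thetaExp 0 i = thetaExp 2 j) :
    thetaExp 0 i = 0 := by
  have hi := two_mul_thetaExp (Or.inl rfl) i
  have hj := two_mul_thetaExp (Or.inr rfl) j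
  rw [h] at hi
  have hprod : (5 * (j - i) - 2) * (5 * (i + j) - 1) = 2 := by linear_combination 5 * hi - 5 * hj
  have h1 : 5 * (i + j) - 1 ∣ 2 := ⟨_, by rw [mul_comm]; exact hprod.symm⟩
  have h2 := Int.le_of_dvd (by norm_num) h1
  have h3 := Int.le_of_dvd (by norm_num) (neg_dvd.2 h1)
  have hs : i + j = 0 := by omega
  rw [hs] at hprod
  have : i = 0 := by omega
  simp [this, thetaExp]

/-- By the recurrence at `ℓ = 0`, `b_2(n)` is odd if and only if exactly one of `b_0(n + 1)` and
`b_1(n + 1)` is; they are never both odd. -/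
theorem odd_nonRascoe_two_iff (n : ℕ) :
    Odd (nonRascoe 2 n) ↔ ∃ j, thetaExp 0 j = n + 1 ∨ thetaExp 2 j = n + 1 := by
  have h := even_nonRascoe_recurrence 0 n
  have h0 := odd_nonRascoe_zero_iff (n + 1)
  have h1 := odd_nonRascoe_one_iff (n + 1)
  have hne : ¬(Odd (nonRascoe 0 (n + 1)) ∧ Odd (nonRascoe 1 (n + 1))) := by
    rw [h0, h1]
    rintro ⟨⟨i, hi⟩, j, hj⟩
    have := thetaExp_zero_eq_zero_of_eq (hi.trans hj.symm)
    omega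
  rw [exists_or, ← h0, ← h1]
  simp only [zero_add, add_zero] at h
  grind

theorem natCast_eq_iff_thetaExp_eq {c : ℤ} (hc : c = 0 ∨ c = 2) (n : ℕ) (j : ℤ) :
    (n : ℤ) = j * (5 * j + 1 - 2 * c) / 2 ↔ thetaExp c j = n := by
  have := two_mul_thetaExp hc j
  omega

end OddValues

/-! ### Gaussian binomial coefficients -/

section Gaussian

open PowerSeries Finset

theorem boxPartitions_natCast (N M s : ℕ) :
    boxPartitions N M s =
      #{π : Nat.Partition s | Multiset.card π.parts ≤ M ∧ ∀ i ∈ π.parts, i ≤ N} := by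
  rw [boxPartitions, Fintype.card_subtype]
  congr 1
  ext π
  simp

theorem boxPartitions_of_neg {N M : ℤ} (h : M < 0 ∨ 0 < M ∧ N < 0) (s : ℕ) :
    boxPartitions N M s = 0 := by
  rw [boxPartitions, Fintype.card_eq_zero_iff]
  refine ⟨fun ⟨π, h1, _, h3⟩ => ?_⟩
  omega

theorem Nat.Partition.eq_zero_of_parts_eq_zero {s : ℕ} {π : Nat.Partition s} (h : π.parts = 0) :
    s = 0 := by
  rw [← π.parts_sum, h, Multiset.sum_zero]

theorem boxPartitions_eq_ite {N M : ℤ} (h : M = 0 ∨ 0 ≤ M ∧ N = 0) (s : ℕ) :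
    boxPartitions N M s = if s = 0 then 1 else 0 := by
  have key : ∀ π : Nat.Partition s, (Multiset.card π.parts : ℤ) ≤ M → (∀ i ∈ π.parts, (i : ℤ) ≤ N) →
      π.parts = 0 := by
    intro π h1 h2
    rcases h with rfl | ⟨-, rfl⟩
    · exact Multiset.card_eq_zero.1 (by omega)
    · refine Multiset.eq_zero_of_forall_notMem fun i hi => ?_
      have := h2 i hi
      have := π.parts_pos hi
      omega
  split_ifs with hs
  · subst hs
    rw [boxPartitions, Fintype.card_eq_one_iff]
    have h0 : (default : Nat.Partition 0).parts = 0 := by simp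
    exact ⟨⟨default, by rw [h0]; simp; omega, by rw [h0]; simp, by omega⟩,
      fun π => Subtype.ext (Subsingleton.elim _ _)⟩
  · rw [boxPartitions, Fintype.card_eq_zero_iff]
    exact ⟨fun ⟨π, h1, h2, _⟩ => hs (Nat.Partition.eq_zero_of_parts_eq_zero (key π h1 h2))⟩

/-- Split the partitions in an `(N + 1) × (M + 1)` box according to whether `N + 1` is a part. -/
theorem boxPartitions_succ_succ (N M s : ℕ) :
    boxPartitions (N + 1 : ℕ) (M + 1 : ℕ) s = boxPartitions N (M + 1 : ℕ) s +
      if N + 1 ≤ s then boxPartitions (N + 1 : ℕ) M (s - (N + 1)) else 0 := by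
  simp only [boxPartitions_natCast]
  rw [card_filter_eq_add_card_filter_not _ _ (fun π : Nat.Partition s => N + 1 ∈ π.parts), add_comm]
  congr 1
  · congr 1
    refine filter_congr fun π _ => ?_
    constructor
    · rintro ⟨⟨h1, h2⟩, h3⟩
      refine ⟨h1, fun i hi => ?_⟩
      have := h2 i hi
      have : i ≠ N + 1 := fun h => h3 (h ▸ hi)
      omega
    · rintro ⟨h1, h2⟩
      exact ⟨⟨h1, fun i hi => (h2 i hi).trans N.le_succ⟩, fun h => absurd (h2 _ h) (by omega)⟩
  · split_ifs with hs
    · symm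
      refine card_bij (fun π _ => ⟨(N + 1) ::ₘ π.parts, fun {i} hi => ?_, ?_⟩) ?_ ?_ ?_
      · rcases Multiset.mem_cons.1 hi with rfl | hi
        · exact N.succ_pos
        · exact π.parts_pos hi
      · rw [Multiset.sum_cons, π.parts_sum]
        omega
      · intro π hπ
        simp only [mem_filter, mem_univ, true_and] at hπ ⊢
        simpa using hπ
      · intro π _ π' _ h
        exact Nat.Partition.ext ((Multiset.cons_inj_right _).1 (congrArg Nat.Partition.parts h))
      · intro π hπ
        simp only [mem_filter, mem_univ, true_and] at hπ
        obtain ⟨⟨h1, h2⟩, h3⟩ := hπ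
        obtain ⟨t, ht⟩ := Multiset.exists_cons_of_mem h3
        have hsum := π.parts_sum
        rw [ht, Multiset.sum_cons] at hsum
        refine ⟨⟨t, fun {i} hi => π.parts_pos (by rw [ht]; exact Multiset.mem_cons_of_mem hi),
          by omega⟩, ?_, ?_⟩
        · simp only [mem_filter, mem_univ, true_and]
          rw [ht, Multiset.card_cons] at h1
          exact ⟨by omega, fun i hi => h2 i (by rw [ht]; exact Multiset.mem_cons_of_mem hi)⟩
        · exact Nat.Partition.ext ht.symm
    · rw [card_eq_zero, filter_eq_empty_iff]
      rintro π - ⟨-, h⟩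
      have := Multiset.single_le_sum (fun i _ => Nat.zero_le i) _ h
      rw [π.parts_sum] at this
      exact hs this

/-- The Gaussian binomial coefficient `[n; k]` modulo 2, as the generating function of the
partitions in an `(n - k) × k` box. -/
noncomputable def gaussianSeries (n k : ℤ) : (ZMod 2)⟦X⟧ :=
  PowerSeries.mk fun s => (boxPartitions (n - k) k s : ZMod 2)

theorem gaussianSeries_of_lt {n k : ℤ} (hn : 0 ≤ n) (h : k < 0 ∨ n < k) :
    gaussianSeries n k = 0 := by
  ext s
  rw [gaussianSeries, coeff_mk, boxPartitions_of_neg (by omega)]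
  simp

theorem gaussianSeries_of_eq {n k : ℤ} (h : k = 0 ∨ 0 ≤ k ∧ n = k) : gaussianSeries n k = 1 := by
  ext s
  rw [gaussianSeries, coeff_mk, boxPartitions_eq_ite (by omega), coeff_one]
  split_ifs <;> simp

/-- The value at `n = -1` reflects the convention that a box of height `0` holds the empty partition
whatever its width. -/
theorem gaussianSeries_neg_one (k : ℤ) : gaussianSeries (-1) k = if k = 0 then 1 else 0 := by
  split_ifs with h
  · exact gaussianSeries_of_eq (Or.inl h)
  · ext s
    rw [gaussianSeries, coeff_mk, boxPartitions_of_neg (by omega)]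
    simp

theorem gaussianSeries_succ_succ {n : ℤ} (hn : 0 ≤ n) (k : ℤ) :
    gaussianSeries (n + 1) (k + 1) =
      gaussianSeries n (k + 1) + X ^ (n - k).toNat * gaussianSeries n k := by
  rcases lt_or_ge k 0 with hk | hk
  · rw [gaussianSeries_of_lt hn (Or.inl hk), mul_zero, add_zero]
    rcases eq_or_ne k (-1) with rfl | hk'
    · rw [gaussianSeries_of_eq (by omega), gaussianSeries_of_eq (by omega)]
    · rw [gaussianSeries_of_lt (by omega) (by omega), gaussianSeries_of_lt hn (by omega)]
  rcases lt_trichotomy k n with h | rfl | h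
  · lift k to ℕ using hk
    obtain ⟨N, rfl⟩ : ∃ N : ℕ, n = k + (N + 1 : ℕ) := ⟨(n - k - 1).toNat, by omega⟩
    ext s
    rw [map_add, coeff_X_pow_mul']
    simp only [gaussianSeries, coeff_mk]
    have := boxPartitions_succ_succ N k s
    rw [show (k : ℤ) + (N + 1 : ℕ) + 1 - (k + 1) = (N + 1 : ℕ) by push_cast; ring,
      show (k : ℤ) + (N + 1 : ℕ) - (k + 1) = N by push_cast; ring, add_sub_cancel_left,
      Int.toNat_natCast, show (k : ℤ) + 1 = (k + 1 : ℕ) by push_cast; ring, this]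
    split_ifs <;> push_cast <;> rfl
  · rw [gaussianSeries_of_eq (by omega), gaussianSeries_of_eq (k := k) (by omega),
      gaussianSeries_of_lt hn (by omega)]
    simp
  · rw [gaussianSeries_of_lt (by omega) (by omega), gaussianSeries_of_lt (k := k) hn (by omega),
      gaussianSeries_of_lt hn (by omega)]
    simp

theorem X_pow_mul_gaussianSeries_congr {n k : ℤ} (hn : 0 ≤ n) {a b : ℕ}
    (h : 0 ≤ k → k ≤ n → a = b) : X ^ a * gaussianSeries n k = X ^ b * gaussianSeries n k := by
  by_cases hk : 0 ≤ k ∧ k ≤ n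
  · rw [h hk.1 hk.2]
  · rw [gaussianSeries_of_lt hn (by omega), mul_zero, mul_zero]

/-- The second `q`-Pascal rule, by induction from the first. -/
theorem gaussianSeries_succ_succ' {n : ℤ} (hn : 0 ≤ n) (k : ℤ) :
    gaussianSeries (n + 1) (k + 1) =
      X ^ (k + 1).toNat * gaussianSeries n (k + 1) + gaussianSeries n k := by
  induction n, hn using Int.leInduction generalizing k with
  | base =>
    rw [gaussianSeries_succ_succ le_rfl]
    by_cases h1 : k = -1
    · subst h1
      simp [gaussianSeries_of_lt (n := 0) (k := -1) le_rfl (by omega)]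
    · rw [gaussianSeries_of_lt (k := k + 1) le_rfl (by omega)]
      by_cases h0 : k = 0
      · subst h0
        simp
      · rw [gaussianSeries_of_lt (k := k) le_rfl (by omega)]
        simp
  | succ n hn ih =>
    have e1 := gaussianSeries_succ_succ (n := n + 1) (by omega) k
    have e2 := gaussianSeries_succ_succ hn k
    have e3 := gaussianSeries_succ_succ hn (k - 1)
    have i1 := ih k
    have i2 := ih (k - 1)
    rw [sub_add_cancel] at e3 i2
    have c1 : X ^ (n + 1 - k).toNat * (X ^ k.toNat * gaussianSeries n k) =
        X ^ (k + 1).toNat * (X ^ (n - k).toNat * gaussianSeries n k) := by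
      rw [← mul_assoc, ← mul_assoc, ← pow_add, ← pow_add]
      exact X_pow_mul_gaussianSeries_congr hn fun h1 h2 => by omega
    rw [show n - (k - 1) = n + 1 - k by ring] at e3
    linear_combination e1 + i1 - X ^ (k + 1).toNat * e2 + X ^ (n + 1 - k).toNat * i2 - e3 + c1

end Gaussian

/-! ### Schur's polynomials -/

section Schur

open PowerSeries Finset

/-- Schur's polynomial `∑ j, q ^ (j (5 j + 1 - 2 c) / 2) [ℓ - 1; ⌊(ℓ - 1 + c - 5 j) / 2⌋]` modulo 2,
cut off at `|j| ≤ K`. The cut-off is immaterial as soon as `ℓ ≤ K`. -/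
noncomputable def schurSeries (c : ℤ) (K ℓ : ℕ) : (ZMod 2)⟦X⟧ :=
  ∑ j ∈ Icc (-K : ℤ) K, X ^ thetaExp c j * gaussianSeries (ℓ - 1) ((ℓ - 1 + c - 5 * j) / 2)

theorem two_eq_zero_powerSeries : (2 : (ZMod 2)⟦X⟧) = 0 :=
  one_add_one_eq_two.symm.trans (powerSeries_add_self 1)

/-- Telescoping in characteristic 2. -/
theorem sum_Icc_add_shift (h : ℤ → (ZMod 2)⟦X⟧) (K : ℕ) :
    ∑ j ∈ Icc (-K : ℤ) K, (h j + h (j + 1)) = h (-K) + h (K + 1) := by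
  rw [sum_Icc_neg_self]
  induction K with
  | zero => simp
  | succ K ih =>
    rw [sum_range_succ, ← add_assoc, ih]
    push_cast
    rw [show -((K : ℤ) + 1) + 1 = -K by ring]
    linear_combination (h (-K) + h (K + 1)) * two_eq_zero_powerSeries

/-- The part of a summand of Schur's polynomial that both `q`-Pascal rules leave over. -/
noncomputable def schurResidue (c : ℤ) (n j : ℤ) : (ZMod 2)⟦X⟧ :=
  if Even (n + c - 5 * j) then
    X ^ (thetaExp c j + ((n + c - 5 * j) / 2 + 1).toNat) *
      gaussianSeries n ((n + c - 5 * j) / 2 + 1)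
  else 0

/-- The `q`-Pascal rules reduce the recurrence to a telescoping sum. Which of the two rules is
applied first depends on the parity of `n + c - 5 j`. -/
theorem gaussianSeries_schur_step {c : ℤ} (hc : c = 0 ∨ c = 2) {n : ℤ} (hn : 0 ≤ n) (j : ℤ) :
    X ^ thetaExp c j * gaussianSeries (n + 2) ((n + 2 + c - 5 * j) / 2) =
      X ^ thetaExp c j * gaussianSeries (n + 1) ((n + 1 + c - 5 * j) / 2) +
      X ^ (n + 1).toNat * (X ^ thetaExp c j * gaussianSeries n ((n + c - 5 * j) / 2)) +
      (schurResidue c n j + schurResidue c n (j + 1)) := by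
  rcases Int.even_or_odd' (n + c - 5 * j) with ⟨k, hk | hk⟩
  · have hE : Even (n + c - 5 * j) := hk ▸ even_two_mul k
    have hO : ¬Even (n + c - 5 * (j + 1)) := by
      rw [show n + c - 5 * (j + 1) = 2 * (k - 3) + 1 by linarith]
      exact Int.not_even_iff_odd.2 (odd_two_mul_add_one _)
    rw [schurResidue, schurResidue, if_pos hE, if_neg hO,
      show (n + 2 + c - 5 * j) / 2 = k + 1 by omega,
      show (n + 1 + c - 5 * j) / 2 = k by omega, show (n + c - 5 * j) / 2 = k by omega]
    have e1 := gaussianSeries_succ_succ' (n := n + 1) (by omega) k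
    have e2 := gaussianSeries_succ_succ hn k
    rw [add_assoc, one_add_one_eq_two] at e1
    have e3 : X ^ (k + 1).toNat * (X ^ (n - k).toNat * gaussianSeries n k) =
        X ^ (n + 1).toNat * gaussianSeries n k := by
      rw [← mul_assoc, ← pow_add]
      exact X_pow_mul_gaussianSeries_congr hn fun h1 h2 => by omega
    rw [pow_add]
    linear_combination X ^ thetaExp c j * e1 + X ^ thetaExp c j * X ^ (k + 1).toNat * e2 +
      X ^ thetaExp c j * e3
  · have hO : ¬Even (n + c - 5 * j) := hk ▸ Int.not_even_iff_odd.2 (odd_two_mul_add_one _)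
    have hE : Even (n + c - 5 * (j + 1)) := by
      rw [show n + c - 5 * (j + 1) = 2 * (k - 2) by linarith]
      exact even_two_mul _
    rw [schurResidue, schurResidue, if_neg hO, if_pos hE,
      show (n + 2 + c - 5 * j) / 2 = k + 1 by omega,
      show (n + 1 + c - 5 * j) / 2 = k + 1 by omega, show (n + c - 5 * j) / 2 = k by omega,
      show (n + c - 5 * (j + 1)) / 2 + 1 = k - 1 by omega]
    have e1 := gaussianSeries_succ_succ (n := n + 1) (by omega) k
    have e2 := gaussianSeries_succ_succ' hn (k - 1)
    rw [add_assoc n, one_add_one_eq_two] at e1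
    rw [sub_add_cancel] at e2
    have e3 : X ^ (n + 1 - k).toNat * (X ^ k.toNat * gaussianSeries n k) =
        X ^ (n + 1).toNat * gaussianSeries n k := by
      rw [← mul_assoc, ← pow_add]
      exact X_pow_mul_gaussianSeries_congr hn fun h1 h2 => by omega
    have e4 : X ^ (thetaExp c j + (n + 1 - k).toNat) * gaussianSeries n (k - 1) =
        X ^ (thetaExp c (j + 1) + (k - 1).toNat) * gaussianSeries n (k - 1) := by
      refine X_pow_mul_gaussianSeries_congr hn fun h1 h2 => ?_
      have h3 := two_mul_thetaExp hc j
      have h4 := two_mul_thetaExp hc (j + 1)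
      have h5 : (2 * (thetaExp c (j + 1) : ℤ)) = 2 * thetaExp c j + 10 * j + 6 - 2 * c := by
        rw [h3, h4]
        ring
      omega
    rw [pow_add] at e4
    linear_combination X ^ thetaExp c j * e1 + X ^ thetaExp c j * X ^ (n + 1 - k).toNat * e2 +
      X ^ thetaExp c j * e3 + e4

/-- Schur's recurrence. It starts at `ℓ = 1`: the `q`-Pascal rules fail for the conventional values
`[-1; k]` that occur at `ℓ = 0`. -/
theorem schurSeries_recurrence {c : ℤ} (hc : c = 0 ∨ c = 2) {K ℓ : ℕ} (hℓ : 1 ≤ ℓ) (hK : ℓ ≤ K) :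
    schurSeries c K (ℓ + 2) = schurSeries c K (ℓ + 1) + X ^ ℓ * schurSeries c K ℓ := by
  obtain ⟨n, rfl⟩ := Nat.exists_eq_add_of_le' hℓ
  have hres : ∀ j : ℤ, j = -K ∨ j = K + 1 → schurResidue c n j = 0 := by
    intro j hj
    rw [schurResidue]
    split_ifs
    · rw [gaussianSeries_of_lt (by omega), mul_zero]
      omega
    · rfl
  have hstep : ∀ j : ℤ, _ := gaussianSeries_schur_step hc (Int.natCast_nonneg n)
  have htel := sum_Icc_add_shift (schurResidue c n) K
  rw [hres _ (Or.inl rfl), hres _ (Or.inr rfl), add_zero] at htel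
  simp only [schurSeries, mul_sum]
  rw [← sum_add_distrib, ← add_zero (∑ j ∈ _, (_ + _)), ← htel, ← sum_add_distrib]
  refine sum_congr rfl fun j _ => ?_
  have h := hstep j
  push_cast
  rw [show (n : ℤ) + 1 + 2 - 1 = n + 2 by ring, show (n : ℤ) + 1 + 1 - 1 = n + 1 by ring,
    show (n : ℤ) + 1 - 1 = n by ring]
  rw [show ((n : ℤ) + 1).toNat = n + 1 by omega] at h
  exact h

theorem schurSeries_eq_one {c : ℤ} {K ℓ : ℕ} (h0 : gaussianSeries (ℓ - 1) ((ℓ - 1 + c) / 2) = 1)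
    (h : ∀ j : ℤ, j ≠ 0 → gaussianSeries (ℓ - 1) ((ℓ - 1 + c - 5 * j) / 2) = 0) :
    schurSeries c K ℓ = 1 := by
  rw [schurSeries, sum_eq_single 0]
  · simpa [thetaExp] using h0
  · intro j _ hj
    rw [h j hj, mul_zero]
  · intro hj
    simp at hj

theorem schurSeries_eq_zero {c : ℤ} {K ℓ : ℕ}
    (h : ∀ j : ℤ, gaussianSeries (ℓ - 1) ((ℓ - 1 + c - 5 * j) / 2) = 0) :
    schurSeries c K ℓ = 0 :=
  sum_eq_zero fun j _ => by rw [h j, mul_zero]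

theorem X_mul_nonRascoeSeries_two :
    X * nonRascoeSeries 2 = nonRascoeSeries 0 + nonRascoeSeries 1 := by
  have h := nonRascoeSeries_recurrence 0
  simp only [zero_add, pow_one] at h
  linear_combination -h - nonRascoeSeries 1 * two_eq_zero_powerSeries

/-- The recurrence solved in terms of its first two members, with Schur's polynomials as
coefficients. -/
theorem X_pow_mul_nonRascoeSeries {K ℓ : ℕ} (hK : ℓ ≤ K) :
    X ^ (ℓ * (ℓ - 1) / 2) * nonRascoeSeries ℓ =
      schurSeries 2 K ℓ * nonRascoeSeries 0 + schurSeries 0 K ℓ * nonRascoeSeries 1 := by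
  induction ℓ using Nat.strong_induction_on with
  | _ ℓ ih =>
    match ℓ with
    | 0 =>
      -- Here the summand `j = 0` contributes through the value `[-1; 0] = 1`.
      rw [schurSeries_eq_one, schurSeries_eq_zero]
      · simp
      all_goals intros; simp only [Nat.cast_zero, zero_sub]; rw [gaussianSeries_neg_one]
      · exact if_neg (by omega)
      · exact if_pos (by norm_num)
      · exact if_neg (by omega)
    | 1 =>
      rw [schurSeries_eq_zero, schurSeries_eq_one (c := 0)]
      · simp
      · exact gaussianSeries_of_eq (by omega)
      all_goals intros; exact gaussianSeries_of_lt (by omega) (by omega)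
    | 2 =>
      rw [schurSeries_eq_one, schurSeries_eq_one (c := 0)]
      · simpa using X_mul_nonRascoeSeries_two
      · exact gaussianSeries_of_eq (by omega)
      · intros; exact gaussianSeries_of_lt (by omega) (by omega)
      · exact gaussianSeries_of_eq (by omega)
      · intros; exact gaussianSeries_of_lt (by omega) (by omega)
    | ℓ + 3 =>
      have i1 := ih (ℓ + 1) (by omega) (by omega)
      have i2 := ih (ℓ + 2) (by omega) (by omega)
      have hrec := nonRascoeSeries_recurrence (ℓ + 1)
      have ha := schurSeries_recurrence (Or.inr rfl) (K := K) (ℓ := ℓ + 1) (by omega) (by omega)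
      have hb := schurSeries_recurrence (Or.inl rfl) (K := K) (ℓ := ℓ + 1) (by omega) (by omega)
      have x2 : (ℓ + 2) * (ℓ + 2 - 1) / 2 = (ℓ + 1) * (ℓ + 1 - 1) / 2 + (ℓ + 1) := by
        rw [show (ℓ + 2) * (ℓ + 2 - 1) = (ℓ + 1) * (ℓ + 1 - 1) + 2 * (ℓ + 1) by
          simp only [Nat.add_sub_cancel, show ℓ + 2 - 1 = ℓ + 1 by omega]; ring]
        omega
      have x3 : (ℓ + 3) * (ℓ + 3 - 1) / 2 = (ℓ + 1) * (ℓ + 1 - 1) / 2 + (ℓ + 1) + (ℓ + 2) := by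
        rw [show (ℓ + 3) * (ℓ + 3 - 1) = (ℓ + 1) * (ℓ + 1 - 1) + 2 * (ℓ + 1 + (ℓ + 2)) by
          simp only [Nat.add_sub_cancel, show ℓ + 3 - 1 = ℓ + 2 by omega]; ring]
        omega
      rw [show ℓ + 1 + 2 = ℓ + 3 by ring, show ℓ + 1 + 1 = ℓ + 2 by ring] at ha hb hrec
      rw [x2] at i2
      rw [x3, ha, hb]
      generalize (ℓ + 1) * (ℓ + 1 - 1) / 2 = t at *
      rw [pow_add] at i2
      rw [pow_add, pow_add]
      linear_combination i2 + X ^ (ℓ + 1) * i1 - X ^ (t : ℕ) * X ^ (ℓ + 1) * hrec -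
        X ^ (t : ℕ) * X ^ (ℓ + 1) * nonRascoeSeries (ℓ + 2) * two_eq_zero_powerSeries

end Schur

/-! ### Comparison of coefficients -/

section LaurentCoefficients

open Finset

theorem thetaCoeff_eq (ℓ : ℕ) (j m : ℤ) (k : ℕ) :
    thetaCoeff ℓ j m k =
      boxPartitions (ℓ - 1 - (ℓ - 1 + 2 - 5 * j) / 2) ((ℓ - 1 + 2 - 5 * j) / 2) k +
      boxPartitions (ℓ - 1 - (ℓ - 1 + 0 - 5 * m) / 2) ((ℓ - 1 + 0 - 5 * m) / 2) k := by
  have hfloor : ∀ a : ℤ, ⌊(a : ℚ) / 2⌋ = a / 2 := fun a => by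
    simpa using Int.floor_div_natCast (a : ℚ) 2
  rw [thetaCoeff, hfloor, hfloor, add_zero, show (ℓ : ℤ) - 1 + 2 = ℓ + 1 by ring]

theorem triangle_natCast (ℓ : ℕ) : (ℓ : ℤ) * (ℓ - 1) / 2 = (ℓ * (ℓ - 1) / 2 : ℕ) := by
  rcases ℓ with _ | ℓ <;> simp

theorem thetaExponent_eq (ℓ : ℕ) (j m : ℤ) (k : ℕ) :
    thetaExponent ℓ j m k = (thetaExp 2 j + thetaExp 0 m + k : ℕ) - (ℓ * (ℓ - 1) / 2 : ℕ) := by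
  have h2 := (natCast_eq_iff_thetaExp_eq (Or.inr rfl) _ j).2 rfl
  have h0 := (natCast_eq_iff_thetaExp_eq (Or.inl rfl) _ m).2 rfl
  rw [thetaExponent, triangle_natCast]
  push_cast
  rw [h2, h0]
  ring_nf

/-- The three contributions to the exponent are nonnegative, and the first two dominate `|j|` and
`|m|`, so that an exponent bounds the indices at which it is attained. -/
theorem mem_box_of_thetaExponent {ℓ N : ℕ} {j m : ℤ} {k : ℕ}
    (h : thetaExponent ℓ j m k = N - (ℓ * (ℓ - 1) / 2 : ℕ)) {K : ℕ} (hK : N < K) :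
    (j, m, k) ∈ Icc (-K : ℤ) K ×ˢ Icc (-K : ℤ) K ×ˢ range K := by
  rw [thetaExponent_eq] at h
  have h1 := le_thetaExp (Or.inr rfl) j
  have h2 := le_thetaExp (Or.inl rfl) m
  simp only [mem_product, mem_Icc, mem_range]
  omega

/-- The summable family of the monomials `thetaCoeff ℓ j m k * q ^ thetaExponent ℓ j m k`. Its
exponents are bounded below, and each is attained by finitely many indices only. -/
noncomputable def thetaFamily (ℓ : ℕ) : HahnSeries.SummableFamily ℤ ℤ (ℤ × ℤ × ℕ) where
  toFun i := HahnSeries.single (thetaExponent ℓ i.1 i.2.1 i.2.2) (thetaCoeff ℓ i.1 i.2.1 i.2.2 : ℤ)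
  isPWO_iUnion_support' := by
    refine (BddBelow.isWF (s := Set.Ici (-(ℓ * (ℓ - 1) / 2 : ℕ) : ℤ)) bddBelow_Ici).isPWO.mono ?_
    refine Set.iUnion_subset fun i => HahnSeries.support_single_subset.trans ?_
    rw [Set.singleton_subset_iff, Set.mem_Ici, thetaExponent_eq]
    omega
  finite_co_support' e := by
    obtain ⟨K, hK⟩ : ∃ K : ℕ, (e + (ℓ * (ℓ - 1) / 2 : ℕ)).toNat < K := ⟨_, Nat.lt_succ_self _⟩
    refine (finite_toSet (Icc (-K : ℤ) K ×ˢ Icc (-K : ℤ) K ×ˢ range K)).subset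
      fun ⟨j, m, k⟩ hi => ?_
    have h : e = thetaExponent ℓ j m k := by
      by_contra h
      exact hi (HahnSeries.coeff_single_of_ne h)
    refine mem_box_of_thetaExponent (ℓ := ℓ) ?_ hK
    rw [thetaExponent_eq] at h ⊢
    omega

open PowerSeries in
theorem coeff_X_pow_mul_gaussianSeries {a N K : ℕ} (hN : N < K) (n k : ℤ) :
    coeff N (X ^ a * gaussianSeries n k) =
      ∑ s ∈ range K, if a + s = N then (boxPartitions (n - k) k s : ZMod 2) else 0 := by
  rw [coeff_X_pow_mul', gaussianSeries, coeff_mk]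
  split_ifs with h
  · rw [sum_eq_single (N - a)]
    · rw [if_pos (by omega)]
    · intro s _ hs
      exact if_neg (by omega)
    · intro hs
      exact absurd (mem_range.2 (by omega)) hs
  · exact (sum_eq_zero fun s _ => if_neg (by omega)).symm

open PowerSeries in
/-- Coefficient extraction from a product of a Schur polynomial and a theta series. -/
theorem coeff_schurSeries_mul_thetaPartial (c d : ℤ) {N K : ℕ} (hN : N < K) (ℓ : ℕ) :
    coeff N (schurSeries c K ℓ * thetaPartial d K) =
      ∑ j ∈ Icc (-K : ℤ) K, ∑ m ∈ Icc (-K : ℤ) K, ∑ k ∈ range K,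
        if thetaExp c j + thetaExp d m + k = N then
          (boxPartitions (ℓ - 1 - (ℓ - 1 + c - 5 * j) / 2) ((ℓ - 1 + c - 5 * j) / 2) k : ZMod 2)
        else 0 := by
  rw [schurSeries, thetaPartial, sum_mul_sum, map_sum]
  refine sum_congr rfl fun j _ => ?_
  rw [map_sum]
  refine sum_congr rfl fun m _ => ?_
  rw [mul_right_comm, ← pow_add, coeff_X_pow_mul_gaussianSeries hN]

open PowerSeries in
theorem coeff_X_pow_mul_nonRascoeSeries (ℓ N : ℕ) {K : ℕ} (hN : N < K) (hK : ℓ ≤ K) :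
    coeff N (X ^ (ℓ * (ℓ - 1) / 2) * nonRascoeSeries ℓ) =
      coeff N (schurSeries 2 K ℓ * thetaPartial 0 K) +
      coeff N (schurSeries 0 K ℓ * thetaPartial 2 K) := by
  rw [X_pow_mul_nonRascoeSeries hK, ← map_add]
  refine coeff_eq_of_X_pow_dvd_sub ?_ hN
  have h0 := (X_pow_dvd_nonRascoeSeries_zero_sub_thetaPartial K).mul_left (schurSeries 2 K ℓ)
  have h1 := (X_pow_dvd_nonRascoeSeries_one_sub_thetaPartial K).mul_left (schurSeries 0 K ℓ)
  convert dvd_add h0 h1 using 1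
  ring

theorem coeff_hsum_thetaFamily (ℓ N : ℕ) {K : ℕ} (hN : N < K) :
    (((thetaFamily ℓ).hsum.coeff (N - (ℓ * (ℓ - 1) / 2 : ℕ)) : ℤ) : ZMod 2) =
      ∑ j ∈ Icc (-K : ℤ) K, ∑ m ∈ Icc (-K : ℤ) K, ∑ k ∈ range K,
        if thetaExp 2 j + thetaExp 0 m + k = N then (thetaCoeff ℓ j m k : ZMod 2) else 0 := by
  classical
  rw [HahnSeries.SummableFamily.coeff_hsum_eq_sum_of_subset
    (t := Icc (-K : ℤ) K ×ˢ Icc (-K : ℤ) K ×ˢ range K), Int.cast_sum, sum_product]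
  · refine sum_congr rfl fun j _ => ?_
    rw [sum_product]
    refine sum_congr rfl fun m _ => sum_congr rfl fun k _ => ?_
    change (((HahnSeries.single (thetaExponent ℓ j m k) (thetaCoeff ℓ j m k : ℤ)).coeff _ : ℤ) :
      ZMod 2) = _
    rw [HahnSeries.coeff_single, thetaExponent_eq]
    by_cases h : thetaExp 2 j + thetaExp 0 m + k = N
    · rw [if_pos (by omega), if_pos h, Int.cast_natCast]
    · rw [if_neg (by omega), if_neg h, Int.cast_zero]
  · rintro ⟨j, m, k⟩ hi
    refine mem_box_of_thetaExponent (ℓ := ℓ) ?_ hN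
    by_contra h
    exact hi (HahnSeries.coeff_single_of_ne (Ne.symm h))

theorem coeff_nonRascoeGenFun_modEq (ℓ : ℕ) (e : ℤ) :
    (nonRascoeGenFun ℓ).coeff e ≡ (thetaFamily ℓ).hsum.coeff e [ZMOD 2] := by
  refine (ZMod.intCast_eq_intCast_iff _ _ 2).1 ?_
  rcases lt_or_ge (e + (ℓ * (ℓ - 1) / 2 : ℕ)) 0 with he | he
  · have h1 : (nonRascoeGenFun ℓ).coeff e = 0 := by
      rw [nonRascoeGenFun, HahnSeries.ofPowerSeries_apply]
      refine HahnSeries.embDomain_of_notMem_range ?_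
      rintro ⟨n, rfl⟩
      have : (n : ℤ) + (ℓ * (ℓ - 1) / 2 : ℕ) < 0 := he
      omega
    have h2 : (thetaFamily ℓ).hsum.coeff e = 0 := by
      rw [HahnSeries.SummableFamily.coeff_hsum]
      refine finsum_eq_zero_of_forall_eq_zero fun i => HahnSeries.coeff_single_of_ne ?_
      rw [thetaExponent_eq]
      omega
    rw [h1, h2]
  -- After multiplication by `q ^ (ℓ (ℓ - 1) / 2)` both sides are power series; the cut-off
  -- `K = N + ℓ + 1` is large enough for the coefficient of `q ^ N`.
  · obtain ⟨N, hN⟩ := Int.eq_ofNat_of_zero_le he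
    obtain rfl : e = N - (ℓ * (ℓ - 1) / 2 : ℕ) := by omega
    have hK : N < N + ℓ + 1 := by omega
    have hgf : (((nonRascoeGenFun ℓ).coeff (N - (ℓ * (ℓ - 1) / 2 : ℕ)) : ℤ) : ZMod 2) =
        PowerSeries.coeff N (PowerSeries.X ^ (ℓ * (ℓ - 1) / 2) * nonRascoeSeries ℓ) := by
      rw [PowerSeries.coeff_X_pow_mul']
      split_ifs with h
      · rw [← Nat.cast_sub h, nonRascoeGenFun, HahnSeries.ofPowerSeries_apply_coeff]
        simp [nonRascoeSeries]
      · rw [nonRascoeGenFun, HahnSeries.ofPowerSeries_apply, HahnSeries.embDomain_of_notMem_range,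
          Int.cast_zero]
        rintro ⟨n, hn⟩
        have : (n : ℤ) = N - (ℓ * (ℓ - 1) / 2 : ℕ) := hn
        omega
    rw [hgf, coeff_hsum_thetaFamily ℓ N hK, coeff_X_pow_mul_nonRascoeSeries ℓ N hK (by omega),
      coeff_schurSeries_mul_thetaPartial 2 0 hK, coeff_schurSeries_mul_thetaPartial 0 2 hK,
      sum_comm (s := Icc _ _) (t := Icc _ _) (f := fun j m => ∑ k ∈ range _,
        if thetaExp 0 j + thetaExp 2 m + k = N then
          (boxPartitions (ℓ - 1 - (ℓ - 1 + 0 - 5 * j) / 2) ((ℓ - 1 + 0 - 5 * j) / 2) k : ZMod 2)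
        else 0)]
    simp only [← sum_add_distrib]
    refine sum_congr rfl fun j _ => sum_congr rfl fun m _ => sum_congr rfl fun k _ => ?_
    rw [thetaCoeff_eq, add_comm (thetaExp 0 m)]
    split_ifs <;> simp

end LaurentCoefficients

theorem mainTheorem8 :
    (∀ ℓ : ℕ,
      ∃ s : HahnSeries.SummableFamily ℤ ℤ (ℤ × ℤ × ℕ),
        (∀ (j m : ℤ) (k : ℕ),
          s (j, m, k) = HahnSeries.single (thetaExponent ℓ j m k) (thetaCoeff ℓ j m k : ℤ)) ∧
        ∀ e : ℤ, (nonRascoeGenFun ℓ).coeff e ≡ s.hsum.coeff e [ZMOD 2]) ∧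
    (∀ n : ℕ, Odd (nonRascoe 1 n) ↔ ∃ m : ℤ, (n : ℤ) = m * (5 * m - 3) / 2) ∧
    (∀ n : ℕ, Odd (nonRascoe 2 n) ↔
      ∃ m : ℤ, (n : ℤ) + 1 = m * (5 * m + 1) / 2 ∨ (n : ℤ) + 1 = m * (5 * m - 3) / 2) := by
  have h2 : ∀ (n : ℕ) (m : ℤ), (n : ℤ) = m * (5 * m - 3) / 2 ↔ thetaExp 2 m = n := fun n m => by
    rw [← natCast_eq_iff_thetaExp_eq (Or.inr rfl), show 5 * m + 1 - 2 * 2 = 5 * m - 3 by ring]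
  have h0 : ∀ (n : ℕ) (m : ℤ), (n : ℤ) = m * (5 * m + 1) / 2 ↔ thetaExp 0 m = n := fun n m => by
    rw [← natCast_eq_iff_thetaExp_eq (Or.inl rfl), mul_zero, sub_zero]
  refine ⟨fun ℓ => ⟨thetaFamily ℓ, fun j m k => rfl, coeff_nonRascoeGenFun_modEq ℓ⟩, fun n => ?_,
    fun n => ?_⟩
  · simp only [h2, odd_nonRascoe_one_iff]
  · simp only [← Nat.cast_succ, h2, h0, odd_nonRascoe_two_iff]
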